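/- Let $\{F_t\}_{t\ge 0}$ be a two-dimensional Lévy-type process, that is, a conservative Feller process on $\mathbb{R}^2$ with càdlàg paths whose Feller generator $(\mathcal{A},\mathcal{D}_{\mathcal{A}})$ satisfies $C_c^\infty(\mathbb{R}^2)\subseteq\mathcal{D}_{\mathcal{A}}$ and $$\mathcal{A}f(x)=-\int_{\mathbb{R}^2}q(x,\xi)e^{i\langle\xi,x\rangle}\hat f(\xi)\,d\xi,\qquad f\in C_c^\infty(\mathbb{R}^2),\quad \hat f(\xi)=(2\pi)^{-2}\int_{\mathbb{R}^2}e^{-i\langle\xi,x\rangle}f(x)\,dx,$$ where the symbol $q$ has the Lévy–Khintchine representation $$q(x,\xi)=a(x)-i\langle\xi,b(x)\rangle+\tfrac12\langle\xi,C(x)\xi\rangle+\int_{\mathbb{R}^2}\bigl(1-e^{i\langle\xi,y\rangle}+i\langle\xi,y\rangle 1_{B_1(0)}(y)\bigr)\,\nu(x,dy)$$ with Borel measurable $a\ge 0$, $b$, and symmetric non-negative definite $C$, and a Borel kernel $\nu(x,dy)$ (the Lévy measure) with $\nu(x,\{0\})=0$ and $\int\min\{1,|y|^2\}\,\nu(x,dy)<\infty$.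 Assume also that $q(x,0)=0$ for all $x$ and that, for some finite $c>0$, $\sup_x|q(x,\xi)|\le c(1+|\xi|^2)$ for all $\xi$. Here $B_u(0)$ is the open ball of radius $u$ around $0$, and $1/0=\infty$. Assume that $q$ is radial in the co-variable, i.e. $q(x,R\xi)=q(x,\xi)$ for all $x,\xi\in\mathbb{R}^2$ and all rotations $R$ of the plane, and that $\nu(x,du\times\mathbb{R})$ is quasi-unimodal uniformly in $x$: there is $u_0>1$ such that for every $x\in\mathbb{R}^2$ the measure $\nu(x,du\times\mathbb{R})$ is symmetric and $u\mapsto\nu(x,(u,\infty)\times\mathbb{R})$ is a finite convex function on $(u_0,\infty)$. (i) One has $$\int_{B_r(0)}\frac{d\xi}{\sup_{x\in\mathbb{R}^2}|q(x,\xi)|}=\infty\quad\text{for some } r>0$$ if, and only if, $$\int_r^\infty\Bigl(\rho\,\sup_{x\in\mathbb{R}^2}\int_0^\rho u\,\nu(x,B_u^c(0))\,du\Bigr)^{-1}d\rho=\infty\quad\text{for some } r>0,$$ and the latter condition holds for some $r>0$ if, and only if, it holds for all $r>0$. (ii) If, in addition, $$\liminf_{|\xi|\to0}\ \inf_{x\in\mathbb{R}^2}\int_{\mathbb{R}^2}\frac{1-\cos\langle\xi,y\rangle}{|\xi|^2}\,\nu(x,dy)=\infty,$$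 then $$\int_{B_r(0)}\frac{d\xi}{\inf_{x\in\mathbb{R}^2}\operatorname{Re}q(x,\xi)}<\infty\quad\text{for some } r>0$$ if, and only if, $$\int_r^\infty\Bigl(\rho\,\inf_{x\in\mathbb{R}^2}\int_0^\rho u\,\nu(x,B_u^c(0))\,du\Bigr)^{-1}d\rho<\infty\quad\text{for some } r>0.$$ -/

import Mathlib

open MeasureTheory ProbabilityTheory Filter Topology Set
open scoped NNReal ENNReal ZeroAtInfty

noncomputable section

namespace LevyType

/-- The state space `ℝ^d` with its Euclidean norm and inner product. -/
abbrev Space (d : ℕ) : Type := EuclideanSpace ℝ (Fin d)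

/-- A (conservative, time-homogeneous) Markov process `(Ω, 𝓕, (ℙ^x), (𝓕_t), (X_t))` with state
space `ℝ^d` and càdlàg paths. -/
structure MarkovProcess (d : ℕ) (Ω : Type*) [m : MeasurableSpace Ω] where
  /-- The filtration `(𝓕_t)`. -/
  filtration : Filtration ℝ≥0 m
  /-- The family `x ↦ ℙ^x`. -/
  law : Kernel (Space d) Ω
  /-- The process `(X_t)`. -/
  path : ℝ≥0 → Ω → Space d
  isMarkovKernel : IsMarkovKernel law
  adapted : ∀ t, Measurable[filtration t] (path t)
  initial : ∀ x, ∀ᵐ ω ∂(law x), path 0 ω = x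
  /-- The Markov property `ℙ^x(X_{s+t} ∈ B | 𝓕_s) = ℙ^{X_s}(X_t ∈ B)`. -/
  markov : ∀ (x : Space d) (s t : ℝ≥0) (A : Set Ω) (B : Set (Space d)),
    MeasurableSet[filtration s] A → MeasurableSet B →
      law x (A ∩ path (s + t) ⁻¹' B) = ∫⁻ ω in A, law (path s ω) (path t ⁻¹' B) ∂(law x)
  rightContinuous : ∀ ω t, ContinuousWithinAt (fun s => path s ω) (Ici t) t
  leftLimits : ∀ ω t, ∃ l, Tendsto (fun s => path s ω) (𝓝[<] t) (𝓝 l)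

/-- The operators `P_t f(x) = 𝔼^x[f(X_t)]`. -/
def MarkovProcess.semigroup {d : ℕ} {Ω : Type*} [MeasurableSpace Ω] (X : MarkovProcess d Ω)
    (t : ℝ≥0) (f : Space d → ℝ) (x : Space d) : ℝ :=
  ∫ ω, f (X.path t ω) ∂(X.law x)

/-- A Feller process: a Markov process whose semigroup maps the space `C₀` of continuous functions
vanishing at infinity into itself and is strongly continuous there. -/
structure FellerProcess (d : ℕ) (Ω : Type*) [MeasurableSpace Ω] extends MarkovProcess d Ω where
  mapsC0 : ∀ (t : ℝ≥0) (f : C₀(Space d, ℝ)),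
    ∃ g : C₀(Space d, ℝ), ∀ x, g x = toMarkovProcess.semigroup t f x
  stronglyContinuous : ∀ f : C₀(Space d, ℝ),
    TendstoUniformly (fun t : ℝ≥0 => toMarkovProcess.semigroup t f) f (𝓝[>] 0)

/-- `f` belongs to the domain of the Feller generator `𝒜`, and `𝒜 f = g`. -/
def FellerProcess.HasGenerator {d : ℕ} {Ω : Type*} [MeasurableSpace Ω] (X : FellerProcess d Ω)
    (f g : C₀(Space d, ℝ)) : Prop :=
  TendstoUniformly (fun (t : ℝ≥0) (x : Space d) => (X.semigroup t f x - f x) / (t : ℝ)) g (𝓝[>] 0)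

/-- A Lévy quadruple `(a(x), b(x), C(x), ν(x, dy))`. -/
structure LevyQuadruple (d : ℕ) where
  a : Space d → ℝ
  b : Space d → Space d
  C : Space d → Matrix (Fin d) (Fin d) ℝ
  ν : Kernel (Space d) (Space d)
  measurable_a : Measurable a
  nonneg_a : ∀ x, 0 ≤ a x
  measurable_b : Measurable b
  measurable_C : ∀ i j, Measurable fun x => C x i j
  posSemidef_C : ∀ x, (C x).PosSemidef
  ν_zero : ∀ x, ν x {0} = 0
  ν_finite : ∀ x, ∫⁻ y, ENNReal.ofReal (min 1 (‖y‖ ^ 2)) ∂(ν x) < ∞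

/-- The Lévy–Khintchine expression
`a(x) - i⟨ξ, b(x)⟩ + ⟨ξ, C(x) ξ⟩ / 2 + ∫ (1 - exp(i⟨ξ, y⟩) + i⟨ξ, y⟩ 1_{B_1(0)}(y)) ν(x, dy)`. -/
def LevyQuadruple.exponent {d : ℕ} (Q : LevyQuadruple d) (x ξ : Space d) : ℂ :=
  (Q.a x : ℂ) - Complex.I * (inner ℝ ξ (Q.b x) : ℝ)
    + 1 / 2 * ((∑ i, ∑ j, ξ i * Q.C x i j * ξ j : ℝ) : ℂ)
    + ∫ y, (1 - Complex.exp (Complex.I * (inner ℝ ξ y : ℝ))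
        + (Metric.ball (0 : Space d) 1).indicator
            (fun z => Complex.I * (inner ℝ ξ z : ℝ)) y) ∂(Q.ν x)

/-- The Fourier transform `(2π)^{-d} ∫ exp(-i⟨ξ, x⟩) f(x) dx`. -/
def fourier {d : ℕ} (f : Space d → ℝ) (ξ : Space d) : ℂ :=
  ((2 * (Real.pi : ℂ)) ^ d)⁻¹ * ∫ x, Complex.exp (-(Complex.I * (inner ℝ ξ x : ℝ))) * (f x : ℂ)

/-- `X` is a Lévy-type process with symbol `q` and Lévy quadruple `Q`. -/
structure IsLevyTypeProcess {d : ℕ} {Ω : Type*} [MeasurableSpace Ω] (X : FellerProcess d Ω)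
    (q : Space d → Space d → ℂ) (Q : LevyQuadruple d) : Prop where
  /-- The test functions lie in the domain of the Feller generator. -/
  testFunctions : ∀ f : C₀(Space d, ℝ), ContDiff ℝ ((⊤ : ℕ∞) : WithTop ℕ∞) f → HasCompactSupport f →
    ∃ g, X.HasGenerator f g
  /-- On test functions the generator is the pseudo-differential operator with symbol `q`. -/
  isSymbol : ∀ f g : C₀(Space d, ℝ), ContDiff ℝ ((⊤ : ℕ∞) : WithTop ℕ∞) f → HasCompactSupport f →
    X.HasGenerator f g → ∀ x, (g x : ℂ) =
      -∫ ξ, q x ξ * Complex.exp (Complex.I * (inner ℝ ξ x : ℝ)) * fourier f ξ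
  /-- `Q` is the Lévy quadruple of `q`. -/
  levyKhintchine : ∀ x ξ, q x ξ = Q.exponent x ξ
  boundedCoefficients : ∃ c : ℝ, 0 < c ∧ ∀ x ξ, ‖q x ξ‖ ≤ c * (1 + ‖ξ‖ ^ 2)
  noKilling : ∀ x, q x 0 = 0

/-- The rotation of the plane by the angle `φ`. -/
def rotation (φ : ℝ) (ξ : Space 2) : Space 2 :=
  !₂[Real.cos φ * ξ 0 - Real.sin φ * ξ 1, Real.sin φ * ξ 0 + Real.cos φ * ξ 1]

/-- The symbol `q(x, ξ)` is radial in the co-variable `ξ`. -/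
def IsRadialSymbol (q : Space 2 → Space 2 → ℂ) : Prop :=
  ∀ x φ ξ, q x (rotation φ ξ) = q x ξ

/-- A symmetric Borel measure on `ℝ` is quasi-unimodal with respect to `x₀` if its tail
`x ↦ μ(x, ∞)` is a (finite) convex function on `(x₀, ∞)`. -/
structure IsQuasiUnimodal (μ : Measure ℝ) (x₀ : ℝ) : Prop where
  symmetric : ∀ B : Set ℝ, MeasurableSet B → μ ((fun x => -x) ⁻¹' B) = μ B
  tail_finite : ∀ x, x₀ < x → μ (Ioi x) < ∞
  convex : ConvexOn ℝ (Ioi x₀) fun x => (μ (Ioi x)).toReal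

/-- The measures `ν(x, du × ℝ)` are quasi-unimodal uniformly in `x`. -/
def UniformlyQuasiUnimodal (ν : Kernel (Space 2) (Space 2)) : Prop :=
  ∃ u₀ : ℝ, 1 < u₀ ∧ ∀ x, IsQuasiUnimodal ((ν x).map fun y => y 0) u₀

/-- `liminf_{|ξ| → 0} inf_x ∫ (1 - cos⟨ξ, y⟩) / |ξ|² ν(x, dy) = ∞`. -/
def SecondMomentBlowUp (ν : Kernel (Space 2) (Space 2)) : Prop :=
  liminf (fun ξ : Space 2 => ⨅ x : Space 2,
    ∫⁻ y, ENNReal.ofReal ((1 - Real.cos (inner ℝ ξ y)) / ‖ξ‖ ^ 2) ∂(ν x)) (𝓝[≠] 0) = ∞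

/-- `∫_{B_r(0)} dξ / sup_x |q(x, ξ)|`, with `1 / 0 = ∞`. -/
def recurrenceIntegral (q : Space 2 → Space 2 → ℂ) (r : ℝ) : ℝ≥0∞ :=
  ∫⁻ ξ in Metric.ball (0 : Space 2) r, (⨆ x, ENNReal.ofReal ‖q x ξ‖)⁻¹

/-- `∫_{B_r(0)} dξ / inf_x Re q(x, ξ)`, with `1 / 0 = ∞`. -/
def transienceIntegral (q : Space 2 → Space 2 → ℂ) (r : ℝ) : ℝ≥0∞ :=
  ∫⁻ ξ in Metric.ball (0 : Space 2) r, (⨅ x, ENNReal.ofReal (q x ξ).re)⁻¹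

/-- `∫_0^ρ u ν(x, B_u^c(0)) du`. -/
def tailIntegral (ν : Kernel (Space 2) (Space 2)) (x : Space 2) (ρ : ℝ) : ℝ≥0∞ :=
  ∫⁻ u in Ioc 0 ρ, ENNReal.ofReal u * ν x (Metric.ball (0 : Space 2) u)ᶜ

/-- `∫_r^∞ (ρ sup_x ∫_0^ρ u ν(x, B_u^c(0)) du)⁻¹ dρ`, with `1 / 0 = ∞`. -/
def supTailIntegral (ν : Kernel (Space 2) (Space 2)) (r : ℝ) : ℝ≥0∞ :=
  ∫⁻ ρ in Ioi r, (ENNReal.ofReal ρ * ⨆ x, tailIntegral ν x ρ)⁻¹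

/-- `∫_r^∞ (ρ inf_x ∫_0^ρ u ν(x, B_u^c(0)) du)⁻¹ dρ`, with `1 / 0 = ∞`. -/
def infTailIntegral (ν : Kernel (Space 2) (Space 2)) (r : ℝ) : ℝ≥0∞ :=
  ∫⁻ ρ in Ioi r, (ENNReal.ofReal ρ * ⨅ x, tailIntegral ν x ρ)⁻¹

end LevyType

end

/-! Radiality makes the symbol real, since conjugating it amounts to ξ ↦ -ξ. Without killing, it
lies between constant multiples of |ξ|² T(x, 1/|ξ|) and |ξ|² (1 + T(x, 1/|ξ|)), uniformly in x,
where T is `tailIntegral`. By the layer cake formula |ξ|² T is half the integral of min(1, |ξ|²|y|²)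
against the Lévy measure. So the upper bound is 1 - cos z ≤ 2 min(1, z²) plus the bounded diffusion
matrix, which accounts for the extra 1.

The lower bound is the heart. Averaging 1 - cos over the frequencies t e_i, 0 < t ≤ |ξ|, removes its
zeros away from the origin. Each Re q(x, t e_i) is at most 4 Re q(x, ξ), because t e_i is a sum of
two vectors of length |ξ| and Re q(x, ·) is subadditive up to a factor 2.

The bounds survive supremum and infimum over x. Polar coordinates and s = 1/|ξ| then give
`lintegral_ball_inv_lt_top_iff`. The extra 1 is absorbed because S, the supremum or infimum of T, is
monotone and nonzero near infinity. The supremum vanishes at a positive radius only if all Lévy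
measures do, and then both integrals diverge; for the infimum, `SecondMomentBlowUp` excludes
vanishing near infinity. -/

namespace LevyType

/-! ### Polar coordinates and comparison of integrals -/

theorem lintegral_comp_norm (f : ℝ → ℝ≥0∞) (hf : Measurable f) :
    ∫⁻ ξ : Space 2, f ‖ξ‖ = ENNReal.ofReal (2 * Real.pi) * ∫⁻ t in Ioi 0, ENNReal.ofReal t * f t := by
  have h := Complex.orthonormalBasisOneI.measurePreserving_repr
  have h1 : ∫⁻ ξ : Space 2, f ‖ξ‖ = ∫⁻ z : ℂ, f ‖z‖ := by
    rw [← h.lintegral_comp (by fun_prop)]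
    simp
  rw [h1, ← Complex.lintegral_comp_polarCoord_symm, polarCoord_target, Measure.volume_eq_prod,
    ← Measure.prod_restrict]
  have h2 : ∀ p : ℝ × ℝ, ‖Complex.polarCoord.symm p‖ = |p.1| := fun p => by
    simp
  simp only [h2, smul_eq_mul]
  rw [lintegral_prod _ (by fun_prop)]
  simp only [lintegral_const, Measure.restrict_apply, MeasurableSet.univ, univ_inter,
    Real.volume_Ioo]
  rw [mul_comm, ← lintegral_mul_const _ (by fun_prop)]
  refine setLIntegral_congr_fun measurableSet_Ioi fun t ht => ?_
  simp only [abs_of_pos (mem_Ioi.1 ht)]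
  ring_nf

theorem setLIntegral_Ioi_inv (f : ℝ → ℝ≥0∞) {r : ℝ} (hr : 0 < r) :
    ∫⁻ s in Ioi r⁻¹, f s = ∫⁻ t in Ioo 0 r, ENNReal.ofReal (t ^ 2)⁻¹ * f t⁻¹ := by
  have him : (fun t : ℝ => t⁻¹) '' Ioo 0 r = Ioi r⁻¹ := by
    ext s
    constructor
    · rintro ⟨t, ⟨h0, h1⟩, rfl⟩
      exact (inv_lt_inv₀ hr h0).2 h1
    · intro hs
      have hs0 : 0 < s := (inv_pos.2 hr).trans hs
      exact ⟨s⁻¹, ⟨inv_pos.2 hs0, inv_lt_of_inv_lt₀ hr hs⟩, inv_inv s⟩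
  rw [← him, lintegral_image_eq_lintegral_abs_deriv_mul measurableSet_Ioo
    (f' := fun t => -(t ^ 2)⁻¹)
    (fun t ht => (hasDerivAt_inv ht.1.ne').hasDerivWithinAt) inv_injective.injOn]
  refine setLIntegral_congr_fun measurableSet_Ioo fun t _ => ?_
  simp only [abs_neg, abs_of_nonneg (inv_nonneg.2 (sq_nonneg t))]

/-- Polar coordinates followed by the inversion `t ↦ 1 / t`. -/
theorem lintegral_ball_inv_sq_mul {G : ℝ → ℝ≥0∞} (hG : Monotone G) {r : ℝ} (hr : 0 < r) :
    ∫⁻ ξ in Metric.ball (0 : Space 2) r, (ENNReal.ofReal (‖ξ‖ ^ 2) * G ‖ξ‖⁻¹)⁻¹ =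
      ENNReal.ofReal (2 * Real.pi) * ∫⁻ s in Ioi r⁻¹, (ENNReal.ofReal s * G s)⁻¹ := by
  have hGm : Measurable G := hG.measurable
  have h1 : ∫⁻ ξ in Metric.ball (0 : Space 2) r, (ENNReal.ofReal (‖ξ‖ ^ 2) * G ‖ξ‖⁻¹)⁻¹ =
      ∫⁻ ξ : Space 2, (Iio r).indicator
        (fun t => (ENNReal.ofReal (t ^ 2) * G t⁻¹)⁻¹) ‖ξ‖ := by
    rw [← lintegral_indicator Metric.isOpen_ball.measurableSet]
    refine lintegral_congr fun ξ => ?_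
    by_cases h : ‖ξ‖ < r <;> simp [indicator, h]
  rw [h1, lintegral_comp_norm _ (Measurable.indicator (by fun_prop) measurableSet_Iio),
    setLIntegral_Ioi_inv _ hr, ← Ioi_inter_Iio, ← Measure.restrict_restrict measurableSet_Ioi,
    Measure.restrict_restrict measurableSet_Ioi, inter_comm,
    ← Measure.restrict_restrict measurableSet_Iio,
    ← lintegral_indicator measurableSet_Iio]
  congr 1
  refine setLIntegral_congr_fun measurableSet_Ioi fun t ht => ?_
  have ht : 0 < t := ht
  by_cases h : t < r
  · simp only [indicator, mem_Iio, h, if_true]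
    have e : ENNReal.ofReal (t ^ 2)⁻¹ = (ENNReal.ofReal (t ^ 2))⁻¹ :=
      ENNReal.ofReal_inv_of_pos (by positivity)
    have e2 : ENNReal.ofReal t⁻¹ = (ENNReal.ofReal t)⁻¹ := ENNReal.ofReal_inv_of_pos ht
    have ht0 : ENNReal.ofReal t ≠ 0 := by simpa using ht
    rw [ENNReal.mul_inv (by simp [ht.ne']) (by simp), e, e2,
      ENNReal.mul_inv (by simp) (by simp [ht]), inv_inv, ENNReal.ofReal_pow ht.le]
    set a := ENNReal.ofReal t
    -- Both sides reduce to t⁻¹ / G(t⁻¹): here the polar Jacobian t meets t⁻², on the other side the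
    -- Jacobian t⁻² of the inversion meets t.
    have : a * (a ^ 2)⁻¹ * (G t⁻¹)⁻¹ = a⁻¹ * (G t⁻¹)⁻¹ := by
      congr 1
      rw [sq, ENNReal.mul_inv (by simp [ht0]) (by simp [a]), ← mul_assoc,
        ENNReal.mul_inv_cancel ht0 (by simp [a]), one_mul]
    rw [← mul_assoc, this, ← mul_assoc, sq, ENNReal.mul_inv (by simp [ht0]) (by simp [a]),
      mul_assoc a⁻¹, ENNReal.inv_mul_cancel ht0 (by simp [a]), mul_one]
  · simp [indicator, h]

theorem lintegral_Ioi_inv_eq_top (r : ℝ) (hr : 0 < r) :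
    ∫⁻ s in Ioi r, (ENNReal.ofReal s)⁻¹ = ∞ := by
  by_contra h
  refine not_integrableOn_Ioi_inv (a := r) ⟨by fun_prop, ?_⟩
  rw [hasFiniteIntegral_iff_ofReal]
  · refine lt_of_le_of_lt (le_of_eq ?_) (lt_top_iff_ne_top.2 h)
    exact setLIntegral_congr_fun measurableSet_Ioi fun t ht =>
      ENNReal.ofReal_inv_of_pos (hr.trans ht)
  · filter_upwards [ae_restrict_mem measurableSet_Ioi] with t ht
    exact inv_nonneg.2 (hr.trans ht).le

/-- If `F(ξ)` lies between multiples of `|ξ|² S(1/|ξ|)` and `|ξ|² (1 + S(1/|ξ|))`, then the integral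
of `1/F` over a ball and the integral of `1/(s S(s))` near infinity are finite together, as long as
`S` does not vanish. -/
theorem lintegral_ball_inv_lt_top_iff {F : Space 2 → ℝ≥0∞} {S : ℝ → ℝ≥0∞} (hS : Monotone S)
    {A B : ℝ≥0∞} (hA : A ≠ 0) (hA' : A ≠ ∞) (hB : B ≠ 0) (hB' : B ≠ ∞)
    (hlow : ∀ ξ ≠ 0, A * (ENNReal.ofReal (‖ξ‖ ^ 2) * S ‖ξ‖⁻¹) ≤ F ξ)
    (hup : ∀ ξ ≠ 0, F ξ ≤ B * (ENNReal.ofReal (‖ξ‖ ^ 2) * (1 + S ‖ξ‖⁻¹)))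
    {r : ℝ} (hr : 0 < r) (hSr : S r⁻¹ ≠ 0) :
    ∫⁻ ξ in Metric.ball (0 : Space 2) r, (F ξ)⁻¹ < ∞ ↔
      ∫⁻ s in Ioi r⁻¹, (ENNReal.ofReal s * S s)⁻¹ < ∞ := by
  have hne : ∀ᵐ ξ : Space 2 ∂volume.restrict (Metric.ball (0 : Space 2) r), ξ ≠ 0 :=
    ae_restrict_of_ae (by simp [ae_iff])
  have hpi : ENNReal.ofReal (2 * Real.pi) ≠ 0 := by simp [Real.pi_pos]
  constructor
  · intro h
    -- On the ball 1/|ξ| ≥ 1/r, where S is bounded below by monotonicity, so 1 + S ≤ K S. The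
    -- minimum with 1 keeps δ finite.
    obtain ⟨K, hK0, hK, hKS⟩ : ∃ K : ℝ≥0∞, K ≠ 0 ∧ K ≠ ∞ ∧ ∀ s, r⁻¹ ≤ s → 1 + S s ≤ K * S s := by
      set δ := min (S r⁻¹) 1
      have hδ : δ ≠ 0 := by simp [δ, hSr]
      have hδ' : δ ≠ ∞ := by simp [δ]
      refine ⟨δ⁻¹ + 1, by simp, by simp [hδ], fun s hs => ?_⟩
      rw [add_mul, one_mul]
      gcongr
      calc 1 = δ⁻¹ * δ := (ENNReal.inv_mul_cancel hδ hδ').symm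
        _ ≤ δ⁻¹ * S s := by gcongr; exact (min_le_left _ _).trans (hS hs)
    have h1 : (B * K)⁻¹ * ∫⁻ ξ in Metric.ball (0 : Space 2) r,
        (ENNReal.ofReal (‖ξ‖ ^ 2) * S ‖ξ‖⁻¹)⁻¹ ≤ ∫⁻ ξ in Metric.ball (0 : Space 2) r, (F ξ)⁻¹ := by
      rw [← lintegral_const_mul' _ _ (by simp [hB, hK0])]
      refine lintegral_mono_ae ?_
      filter_upwards [hne, ae_restrict_mem Metric.isOpen_ball.measurableSet] with ξ hξ hξr
      rw [← ENNReal.mul_inv (by simp [hB, hK0]) (by simp [hB', hK, ENNReal.mul_ne_top]),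
        ENNReal.inv_le_inv]
      refine (hup ξ hξ).trans ?_
      rw [mul_assoc, mul_left_comm K]
      gcongr
      have h0 : 0 < ‖ξ‖ := norm_pos_iff.2 hξ
      refine hKS _ ((inv_le_inv₀ hr h0).2 ?_)
      simpa using (mem_ball_zero_iff.1 hξr).le
    rw [lintegral_ball_inv_sq_mul hS hr] at h1
    have h2 := h1.trans_lt h
    by_contra hcon
    rw [not_lt, top_le_iff] at hcon
    rw [hcon, ENNReal.mul_top hpi, ENNReal.mul_top (by simp [hB', hK, ENNReal.mul_ne_top])] at h2
    exact lt_irrefl _ h2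
  · intro h
    have h1 : ∫⁻ ξ in Metric.ball (0 : Space 2) r, (F ξ)⁻¹ ≤ A⁻¹ *
        ∫⁻ ξ in Metric.ball (0 : Space 2) r, (ENNReal.ofReal (‖ξ‖ ^ 2) * S ‖ξ‖⁻¹)⁻¹ := by
      rw [← lintegral_const_mul' _ _ (by simp [hA])]
      refine lintegral_mono_ae ?_
      filter_upwards [hne] with ξ hξ
      rw [← ENNReal.mul_inv (by simp [hA]) (by simp [hA']), ENNReal.inv_le_inv]
      exact hlow ξ hξ
    rw [lintegral_ball_inv_sq_mul hS hr] at h1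
    refine h1.trans_lt (ENNReal.mul_lt_top (by simp [hA, lt_top_iff_ne_top])
      (ENNReal.mul_lt_top ENNReal.ofReal_lt_top h))

/-- |ξ|⁻² is not integrable at the origin of the plane. This serves the degenerate case of vanishing
Lévy measures. -/
theorem lintegral_ball_inv_eq_top {F : Space 2 → ℝ≥0∞} {B : ℝ≥0∞} (hB' : B ≠ ∞)
    (hup : ∀ ξ ≠ 0, F ξ ≤ B * ENNReal.ofReal (‖ξ‖ ^ 2)) {r : ℝ} (hr : 0 < r) :
    ∫⁻ ξ in Metric.ball (0 : Space 2) r, (F ξ)⁻¹ = ∞ := by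
  have hne : ∀ᵐ ξ : Space 2 ∂volume.restrict (Metric.ball (0 : Space 2) r), ξ ≠ 0 :=
    ae_restrict_of_ae (by simp [ae_iff])
  rw [← top_le_iff]
  -- B + 1 replaces B so that the inverse is finite even for B = 0.
  calc ∞ = (B + 1)⁻¹ * ∫⁻ ξ in Metric.ball (0 : Space 2) r, (ENNReal.ofReal (‖ξ‖ ^ 2) * 1)⁻¹ := by
        rw [lintegral_ball_inv_sq_mul (G := fun _ => 1) monotone_const hr]
        simp only [mul_one]
        rw [lintegral_Ioi_inv_eq_top _ (inv_pos.2 hr), ENNReal.mul_top (by simp [Real.pi_pos]),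
          ENNReal.mul_top (by simp [hB'])]
    _ ≤ _ := by
      rw [← lintegral_const_mul' _ _ (by simp)]
      refine lintegral_mono_ae ?_
      filter_upwards [hne] with ξ hξ
      rw [← ENNReal.mul_inv (by simp) (by simp [hB']), ENNReal.inv_le_inv, mul_one]
      exact (hup ξ hξ).trans (by gcongr; exact le_self_add)

/-! ### Trigonometric inequalities -/

section RealBounds

theorem one_sub_cos_nonneg (z : ℝ) : 0 ≤ 1 - Real.cos z := sub_nonneg.2 (Real.cos_le_one z)

/-- Since 1 - cos z = 2 sin²(z/2), this is |sin(α + β)| ≤ |sin α| + |sin β| followed by (u + v)² ≤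
2u² + 2v². -/
theorem one_sub_cos_add_le (a b : ℝ) :
    1 - Real.cos (a + b) ≤ 2 * (1 - Real.cos a) + 2 * (1 - Real.cos b) := by
  have h : ∀ z, 1 - Real.cos z = 2 * Real.sin (z / 2) ^ 2 := fun z => by
    rw [Real.sin_sq_eq_half_sub]; ring_nf
  rw [h, h, h, add_div, Real.sin_add]
  have ha := Real.sin_sq_add_cos_sq (a / 2)
  have hb := Real.sin_sq_add_cos_sq (b / 2)
  set s := Real.sin (a / 2)
  set c := Real.cos (a / 2)
  set s' := Real.sin (b / 2)
  set c' := Real.cos (b / 2)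
  have h1 : s ^ 2 * c' ^ 2 ≤ s ^ 2 := mul_le_of_le_one_right (sq_nonneg _) (by nlinarith)
  have h2 : c ^ 2 * s' ^ 2 ≤ s' ^ 2 := mul_le_of_le_one_left (sq_nonneg _) (by nlinarith)
  nlinarith [sq_nonneg (s * c' - c * s')]

theorem one_sub_cos_le_two_mul_min (z w : ℝ) (h : z ^ 2 ≤ w) :
    1 - Real.cos z ≤ 2 * min 1 w := by
  have h1 := Real.one_sub_sq_div_two_le_cos (x := z)
  have h2 := Real.neg_one_le_cos z
  rcases min_cases 1 w with ⟨e, _⟩ | ⟨e, _⟩ <;> rw [e] <;> nlinarith [sq_nonneg z]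

theorem sin_le_sub_mul_min {z : ℝ} (hz : 0 ≤ z) :
    Real.sin z ≤ z - z / 20 * min 1 (z ^ 2) := by
  have key : ∀ y : ℝ, 0 ≤ y → y ≤ 1 → Real.sin y ≤ y - y ^ 3 / 10 := fun y h0 h1 => by
    have h := (abs_le.1 (Real.sin_bound (abs_le.2 ⟨by linarith, h1⟩))).2
    rw [abs_of_nonneg h0] at h
    have h3 : y ^ 5 ≤ y ^ 3 := pow_le_pow_of_le_one h0 h1 (by norm_num)
    have h4 : 0 ≤ y ^ 3 := by positivity
    linarith
  rcases le_total z 1 with h1 | h1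
  · have h4 : 0 ≤ z ^ 3 := by positivity
    rw [min_eq_right (by nlinarith)]
    have := key z hz h1
    nlinarith
  · rw [min_eq_left (by nlinarith)]
    -- Beyond 20/19, sin z ≤ 1 ≤ 19z/20. Before it, sin 1 ≤ 9/10 and sin grows with slope at most 1,
    -- so sin z ≤ z - 1/10 ≤ z - z/20.
    by_cases h2 : z ≤ 20 / 19
    · have hd : Real.sin z - Real.sin 1 ≤ z - 1 := by
        have h3 : ∀ u : ℝ, Real.sin z - Real.sin 1 = 2 * Real.sin ((z - 1) / 2) *
          Real.cos ((z + 1) / 2) := fun _ => Real.sin_sub_sin z 1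
        rw [h3 0]
        have h5 : Real.sin ((z - 1) / 2) ≤ (z - 1) / 2 := Real.sin_le (by linarith)
        have h6 : 0 ≤ Real.sin ((z - 1) / 2) :=
          Real.sin_nonneg_of_nonneg_of_le_pi (by linarith) (by linarith [Real.pi_gt_three])
        nlinarith [Real.cos_le_one ((z + 1) / 2)]
      have := key 1 zero_le_one le_rfl
      linarith
    · have := Real.sin_le_one z
      linarith

theorem integral_one_sub_cos_mul_ge {ρ : ℝ} (hρ : 0 < ρ) (u : ℝ) :
    ρ / 20 * min 1 (ρ ^ 2 * u ^ 2) ≤ ∫ t in 0..ρ, (1 - Real.cos (t * u)) := by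
  wlog hu : 0 < u generalizing u
  · rcases (not_lt.1 hu).eq_or_lt with rfl | hu
    · simp
    · simpa using this (-u) (neg_pos.2 hu)
  have h : ∫ t in 0..ρ, (1 - Real.cos (t * u)) = ρ - Real.sin (ρ * u) / u := by
    rw [intervalIntegral.integral_sub (by simp) (Continuous.intervalIntegrable (by fun_prop) _ _)]
    simp [intervalIntegral.integral_comp_mul_right _ hu.ne', div_eq_inv_mul]
  rw [h, ← mul_pow]
  have h1 := div_le_div_of_nonneg_right (sin_le_sub_mul_min (mul_pos hρ hu).le) hu.le
  have h2 : (ρ * u - ρ * u / 20 * min 1 ((ρ * u) ^ 2)) / u = ρ - ρ / 20 * min 1 ((ρ * u) ^ 2) := by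
    field_simp
  linarith

end RealBounds

theorem ofNat_mul_ofReal (n : ℕ) [n.AtLeastTwo] (r : ℝ) :
    (ofNat(n) : ℝ≥0∞) * ENNReal.ofReal r = ENNReal.ofReal (ofNat(n) * r) := by
  rw [ENNReal.ofReal_mul (Nat.ofNat_nonneg n), ENNReal.ofReal_ofNat]

/-! ### Truncated second moments of a Lévy measure -/

section Measure

variable {d : ℕ} {μ : Measure (Space d)}

/-- Weighting by min(1, |y|²) gives a finite measure; the weight vanishes only at the null set {0},
so it can be divided out. Tonelli's theorem needs this later. -/
theorem sFinite_of_lintegral_min_lt_top (h0 : μ {0} = 0)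
    (h : ∫⁻ y, ENNReal.ofReal (min 1 (‖y‖ ^ 2)) ∂μ < ∞) : SFinite μ := by
  have hm : Measurable fun y : Space d => ENNReal.ofReal (min 1 (‖y‖ ^ 2)) := by fun_prop
  rw [← withDensity_inv_same hm (μ := μ) _ (by simp)]
  · have := isFiniteMeasure_withDensity h.ne
    infer_instance
  · rw [ae_iff]
    convert h0 using 2
    ext y
    simp

/-- Layer cake for min(|y|, 1/ρ) with weight t: the primitive t²/2 yields the factor 2, the
truncation the upper limit 1/ρ. -/
theorem lintegral_min_sq (ν : Kernel (Space 2) (Space 2)) (x : Space 2) {ρ : ℝ} (hρ : 0 < ρ) :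
    ∫⁻ y, ENNReal.ofReal (min 1 (ρ ^ 2 * ‖y‖ ^ 2)) ∂(ν x) =
      2 * (ENNReal.ofReal (ρ ^ 2) * tailIntegral ν x ρ⁻¹) := by
  have h := lintegral_comp_eq_lintegral_meas_le_mul (ν x) (f := fun y : Space 2 => min ‖y‖ ρ⁻¹)
    (g := fun t => t) (Eventually.of_forall fun y => by simp [hρ.le]) (by fun_prop)
    (fun t _ => continuous_id.intervalIntegrable _ _)
    (by filter_upwards [ae_restrict_mem measurableSet_Ioi] with t ht using (mem_Ioi.1 ht).le)
  have h1 : ∫⁻ t in Ioi 0, ν x {a | t ≤ min ‖a‖ ρ⁻¹} * ENNReal.ofReal t =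
      tailIntegral ν x ρ⁻¹ := by
    rw [tailIntegral, ← Ioi_inter_Iic, inter_comm, ← Measure.restrict_restrict measurableSet_Iic,
      ← lintegral_indicator measurableSet_Iic]
    refine setLIntegral_congr_fun measurableSet_Ioi fun t _ => ?_
    by_cases ht : t ≤ ρ⁻¹
    · simp only [indicator, mem_Iic, ht, if_true, le_min_iff, and_true]
      rw [mul_comm]
      congr 2
      ext a
      simp
    · simp [indicator, ht]
  rw [← h1, ← h, ← lintegral_const_mul' _ _ (by simp), ← lintegral_const_mul' _ _ (by simp)]
  refine lintegral_congr fun y => ?_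
  rw [← ENNReal.ofReal_mul (by positivity), ofNat_mul_ofReal]
  congr 1
  rw [integral_id]
  rcases le_total ‖y‖ ρ⁻¹ with hy | hy
  · have : ρ * ‖y‖ ≤ 1 := by rwa [← le_div_iff₀' hρ, one_div]
    rw [min_eq_left hy, min_eq_right (by rw [← mul_pow]; exact pow_le_one₀ (by positivity) this)]
    ring
  · have : 1 ≤ ρ * ‖y‖ := by rwa [← div_le_iff₀' hρ, one_div]
    rw [min_eq_right hy, min_eq_left (by rw [← mul_pow]; exact one_le_pow₀ this)]
    field_simp
    ring

theorem tailIntegral_mono (ν : Kernel (Space 2) (Space 2)) (x : Space 2) :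
    Monotone (tailIntegral ν x) := fun _ _ h =>
  lintegral_mono_set (Ioc_subset_Ioc_right h)

/-- The function `min 1 |y|²` controls the oscillating part of the Lévy–Khintchine integrand. -/
theorem integrable_min_norm_sq (h : ∫⁻ y, ENNReal.ofReal (min 1 (‖y‖ ^ 2)) ∂μ < ∞) :
    Integrable (fun y : Space d => min 1 (‖y‖ ^ 2)) μ := by
  refine ⟨by fun_prop, ?_⟩
  rwa [hasFiniteIntegral_iff_ofReal (Eventually.of_forall fun y => by positivity)]

theorem sq_inner_le (ξ y : Space d) : (inner ℝ ξ y) ^ 2 ≤ ‖ξ‖ ^ 2 * ‖y‖ ^ 2 := by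
  rw [← mul_pow, ← sq_abs]
  gcongr
  exact abs_real_inner_le_norm ξ y

theorem integrable_one_sub_cos (h : ∫⁻ y, ENNReal.ofReal (min 1 (‖y‖ ^ 2)) ∂μ < ∞) (ξ : Space d) :
    Integrable (fun y : Space d => 1 - Real.cos (inner ℝ ξ y)) μ := by
  refine ((integrable_min_norm_sq h).const_mul (2 * (1 + ‖ξ‖ ^ 2))).mono' (by fun_prop)
    (Eventually.of_forall fun y => ?_)
  rw [Real.norm_of_nonneg (one_sub_cos_nonneg _)]
  refine (one_sub_cos_le_two_mul_min _ _ (sq_inner_le ξ y)).trans ?_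
  rw [mul_assoc]
  gcongr
  rw [mul_min_of_nonneg _ _ (by positivity)]
  refine min_le_min ?_ ?_ <;> nlinarith [sq_nonneg ‖ξ‖, sq_nonneg ‖y‖]

theorem integrable_levyKhintchine (h : ∫⁻ y, ENNReal.ofReal (min 1 (‖y‖ ^ 2)) ∂μ < ∞)
    (ξ : Space d) :
    Integrable (fun y : Space d => 1 - Complex.exp (Complex.I * (inner ℝ ξ y : ℝ))
        + (Metric.ball (0 : Space d) 1).indicator
            (fun z => Complex.I * (inner ℝ ξ z : ℝ)) y) μ := by
  refine ((integrable_min_norm_sq h).const_mul (3 * (1 + ‖ξ‖ ^ 2))).mono' ?_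
    (Eventually.of_forall fun y => ?_)
  · exact (Measurable.add (by fun_prop)
      (Measurable.indicator (by fun_prop) Metric.isOpen_ball.measurableSet)).aestronglyMeasurable
  have hexp : ‖Complex.exp (Complex.I * (inner ℝ ξ y : ℝ))‖ = 1 := by
    rw [mul_comm]; exact Complex.norm_exp_ofReal_mul_I _
  have hnorm : ‖Complex.I * ((inner ℝ ξ y : ℝ) : ℂ)‖ = |inner ℝ ξ y| := by simp
  have hsq := sq_inner_le ξ y
  by_cases hy : ‖y‖ < 1
  · rw [indicator_of_mem (by simpa using hy), min_eq_right (by nlinarith [norm_nonneg y])]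
    have hle : (inner ℝ ξ y) ^ 2 ≤ (1 + ‖ξ‖ ^ 2) * ‖y‖ ^ 2 := by nlinarith [sq_nonneg ‖y‖]
    -- For small ⟨ξ, y⟩ the compensator cancels the linear Taylor term; otherwise 1 + 1 + |⟨ξ, y⟩| ≤
    -- 3⟨ξ, y⟩².
    by_cases hz : |inner ℝ ξ y| ≤ 1
    · have := Complex.norm_exp_sub_one_sub_id_le (hnorm.trans_le hz)
      rw [hnorm, sq_abs] at this
      rw [show ∀ a b : ℂ, 1 - a + b = -(a - 1 - b) by intros; ring, norm_neg]
      nlinarith [sq_nonneg (inner ℝ ξ y)]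
    · rw [not_le] at hz
      refine (norm_add_le _ _).trans ?_
      refine (add_le_add (norm_sub_le _ _) le_rfl).trans ?_
      rw [hexp, hnorm, norm_one]
      have : (inner ℝ ξ y) ^ 2 = |inner ℝ ξ y| ^ 2 := (sq_abs _).symm
      nlinarith
  · rw [indicator_of_notMem (by simpa using hy), add_zero]
    rw [not_lt] at hy
    rw [min_eq_left (one_le_pow₀ hy)]
    refine (norm_sub_le _ _).trans ?_
    rw [hexp, norm_one]
    nlinarith [sq_nonneg ‖ξ‖]

end Measure

/-! ### The real part of the Lévy–Khintchine exponent -/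

section Symbol

variable {d : ℕ} (Q : LevyQuadruple d)

theorem LevyQuadruple.re_exponent (x ξ : Space d) :
    (Q.exponent x ξ).re = Q.a x + 1 / 2 * (∑ i, ∑ j, ξ i * Q.C x i j * ξ j)
      + ∫ y, (1 - Real.cos (inner ℝ ξ y)) ∂(Q.ν x) := by
  have hre := integral_re (integrable_levyKhintchine (Q.ν_finite x) ξ)
  have hI : ∫ y, RCLike.re (1 - Complex.exp (Complex.I * (inner ℝ ξ y : ℝ))
        + (Metric.ball (0 : Space d) 1).indicator
            (fun z => Complex.I * (inner ℝ ξ z : ℝ)) y) ∂(Q.ν x) =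
      ∫ y, (1 - Real.cos (inner ℝ ξ y)) ∂(Q.ν x) := by
    refine integral_congr_ae (Eventually.of_forall fun y => ?_)
    have h1 : (Complex.exp (Complex.I * (inner ℝ ξ y : ℝ))).re = Real.cos (inner ℝ ξ y) := by
      rw [mul_comm]; exact Complex.exp_ofReal_mul_I_re _
    by_cases hy : ‖y‖ < 1 <;> simp [indicator, hy, h1]
  rw [hI] at hre
  have h2 : ∀ (w : ℂ) (r s u : ℝ), (((r : ℂ) - Complex.I * (s : ℂ)) + 1 / 2 * (u : ℂ) + w).re
      = r + 1 / 2 * u + w.re := fun w r s u => by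
    simp
  rw [LevyQuadruple.exponent, h2, hre]
  rfl

theorem LevyQuadruple.conj_exponent (x ξ : Space d) :
    (starRingEnd ℂ) (Q.exponent x ξ) = Q.exponent x (-ξ) := by
  unfold LevyQuadruple.exponent
  simp only [map_add, map_sub, map_mul, Complex.conj_ofReal, Complex.conj_I, ← integral_conj,
    inner_neg_left, map_one, map_div₀, map_ofNat, PiLp.neg_apply, neg_mul, mul_neg, neg_neg,
    Complex.ofReal_neg]
  congr 1
  refine integral_congr_ae (Eventually.of_forall fun y => ?_)
  simp only [← Complex.exp_conj, map_mul, Complex.conj_I, Complex.conj_ofReal, neg_mul]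
  congr 1
  by_cases hy : ‖y‖ < 1 <;> simp [indicator, hy]

theorem LevyQuadruple.quadratic_nonneg (x ξ : Space d) :
    0 ≤ ∑ i, ∑ j, ξ i * Q.C x i j * ξ j := by
  have h := (Q.posSemidef_C x).2 (Finsupp.equivFunOnFinite.symm fun i => ξ i)
  rw [Finsupp.sum_fintype _ _ (by simp)] at h
  refine h.trans_eq (Finset.sum_congr rfl fun i _ => ?_)
  rw [Finsupp.sum_fintype _ _ (by simp)]
  rfl

theorem LevyQuadruple.quadratic_smul (x ξ : Space d) (t : ℝ) :
    ∑ i, ∑ j, (t • ξ) i * Q.C x i j * (t • ξ) j = t ^ 2 * ∑ i, ∑ j, ξ i * Q.C x i j * ξ j := by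
  simp only [Finset.mul_sum, PiLp.smul_apply, smul_eq_mul]
  refine Finset.sum_congr rfl fun i _ => Finset.sum_congr rfl fun j _ => ?_
  ring

/-- The parallelogram identity, dropping the nonnegative value of the form at a - b. -/
theorem LevyQuadruple.quadratic_add_le (x a b : Space d) :
    ∑ i, ∑ j, (a + b) i * Q.C x i j * (a + b) j ≤
      2 * (∑ i, ∑ j, a i * Q.C x i j * a j) + 2 * (∑ i, ∑ j, b i * Q.C x i j * b j) := by
  have h := Q.quadratic_nonneg x (a - b)
  have e : (∑ i, ∑ j, (a + b) i * Q.C x i j * (a + b) j) +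
      (∑ i, ∑ j, (a - b) i * Q.C x i j * (a - b) j) =
      2 * (∑ i, ∑ j, a i * Q.C x i j * a j) + 2 * (∑ i, ∑ j, b i * Q.C x i j * b j) := by
    simp only [Finset.mul_sum, ← Finset.sum_add_distrib, PiLp.add_apply, PiLp.sub_apply]
    refine Finset.sum_congr rfl fun i _ => Finset.sum_congr rfl fun j _ => ?_
    ring
  linarith

theorem LevyQuadruple.exponent_zero (x : Space d) : Q.exponent x 0 = Q.a x := by
  simp [LevyQuadruple.exponent]

theorem LevyQuadruple.re_exponent_add_le (x a b : Space d) (h0 : Q.a x = 0) :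
    (Q.exponent x (a + b)).re ≤ 2 * (Q.exponent x a).re + 2 * (Q.exponent x b).re := by
  have hint := integrable_one_sub_cos (Q.ν_finite x)
  have h1 : ∫ y, (1 - Real.cos (inner ℝ (a + b) y)) ∂(Q.ν x) ≤
      2 * ∫ y, (1 - Real.cos (inner ℝ a y)) ∂(Q.ν x) +
      2 * ∫ y, (1 - Real.cos (inner ℝ b y)) ∂(Q.ν x) := by
    rw [← integral_const_mul, ← integral_const_mul,
      ← integral_add ((hint a).const_mul 2) ((hint b).const_mul 2)]
    refine integral_mono (hint _) (((hint a).const_mul 2).add ((hint b).const_mul 2)) fun y => ?_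
    simp only [inner_add_left]
    exact one_sub_cos_add_le _ _
  have h2 := Q.quadratic_add_le x a b
  simp only [Q.re_exponent, h0]
  linarith

theorem LevyQuadruple.lintegral_one_sub_cos_le (x ξ : Space d) :
    ∫⁻ y, ENNReal.ofReal (1 - Real.cos (inner ℝ ξ y)) ∂(Q.ν x) ≤
      ENNReal.ofReal (Q.exponent x ξ).re := by
  rw [← ofReal_integral_eq_lintegral_ofReal (integrable_one_sub_cos (Q.ν_finite x) ξ)
    (Eventually.of_forall fun y => one_sub_cos_nonneg _)]
  refine ENNReal.ofReal_le_ofReal ?_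
  rw [Q.re_exponent]
  linarith [Q.nonneg_a x, Q.quadratic_nonneg x ξ]

end Symbol

/-! ### Two-sided bounds for radial symbols -/

theorem norm_sq_eq (ξ : Space 2) : ‖ξ‖ ^ 2 = ξ 0 ^ 2 + ξ 1 ^ 2 := by
  rw [EuclideanSpace.real_norm_sq_eq, Fin.sum_univ_two]

theorem exists_rotation_eq (ξ : Space 2) : ∃ φ, rotation φ !₂[‖ξ‖, 0] = ξ := by
  set z : ℂ := ⟨ξ 0, ξ 1⟩ with hz
  have hn : ‖z‖ = ‖ξ‖ := by
    rw [← sq_eq_sq₀ (norm_nonneg _) (norm_nonneg _), norm_sq_eq, Complex.sq_norm,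
      Complex.normSq_apply]
    ring
  refine ⟨z.arg, ?_⟩
  have h0 := Complex.norm_mul_cos_arg z
  have h1 := Complex.norm_mul_sin_arg z
  rw [hn] at h0 h1
  ext i
  fin_cases i
  · simpa [rotation, mul_comm] using h0
  · simpa [rotation, mul_comm] using h1

theorem IsRadialSymbol.eq_of_norm_eq {q : Space 2 → Space 2 → ℂ} (hq : IsRadialSymbol q)
    (x : Space 2) {ξ η : Space 2} (h : ‖ξ‖ = ‖η‖) : q x ξ = q x η := by
  have key : ∀ ξ, q x ξ = q x !₂[‖ξ‖, 0] := fun ξ => by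
    obtain ⟨φ, hφ⟩ := exists_rotation_eq ξ
    rw [← hq x φ !₂[‖ξ‖, 0], hφ]
  rw [key, key η, h]

theorem LevyQuadruple.im_exponent_eq_zero {Q : LevyQuadruple 2} (hQ : IsRadialSymbol Q.exponent)
    (x ξ : Space 2) : (Q.exponent x ξ).im = 0 := by
  rw [← Complex.conj_eq_iff_im, Q.conj_exponent]
  exact hQ.eq_of_norm_eq x (norm_neg ξ)

theorem LevyQuadruple.re_exponent_nonneg {d : ℕ} (Q : LevyQuadruple d) (x ξ : Space d) :
    0 ≤ (Q.exponent x ξ).re := by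
  rw [Q.re_exponent]
  have := integral_nonneg (μ := Q.ν x) (f := fun y : Space d => 1 - Real.cos (inner ℝ ξ y))
    fun y => one_sub_cos_nonneg _
  linarith [Q.nonneg_a x, Q.quadratic_nonneg x ξ]

theorem LevyQuadruple.norm_exponent {Q : LevyQuadruple 2} (hQ : IsRadialSymbol Q.exponent)
    (x ξ : Space 2) : ‖Q.exponent x ξ‖ = (Q.exponent x ξ).re := by
  have h : Q.exponent x ξ = ((Q.exponent x ξ).re : ℂ) :=
    Complex.ext rfl (by simpa using Q.im_exponent_eq_zero hQ x ξ)
  rw [h, Complex.norm_real, Real.norm_of_nonneg (Q.re_exponent_nonneg x ξ), Complex.ofReal_re]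

/-- A vector of length at most `2|ξ|` is a sum of two vectors of length `|ξ|`. -/
theorem LevyQuadruple.re_exponent_le_four_mul {Q : LevyQuadruple 2}
    (hQ : IsRadialSymbol Q.exponent) {x : Space 2} (h0 : Q.a x = 0) {ξ η : Space 2}
    (h : ‖η‖ ≤ 2 * ‖ξ‖) : (Q.exponent x η).re ≤ 4 * (Q.exponent x ξ).re := by
  -- The height of the isosceles triangle with base |η| and legs |ξ|; the legs (|η|/2, ±s) sum to
  -- (|η|, 0).
  set s := Real.sqrt (‖ξ‖ ^ 2 - (‖η‖ / 2) ^ 2)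
  have hs : s ^ 2 = ‖ξ‖ ^ 2 - (‖η‖ / 2) ^ 2 :=
    Real.sq_sqrt (by nlinarith [norm_nonneg η, norm_nonneg ξ])
  have hn : ∀ u : ℝ, u ^ 2 = s ^ 2 → ‖(!₂[‖η‖ / 2, u] : Space 2)‖ = ‖ξ‖ := fun u hu => by
    rw [← sq_eq_sq₀ (norm_nonneg _) (norm_nonneg _), norm_sq_eq]
    simp only [Matrix.cons_val_zero, Matrix.cons_val_one]
    rw [hu, hs]
    ring
  have hη : ‖η‖ = ‖(!₂[‖η‖ / 2, s] : Space 2) + !₂[‖η‖ / 2, -s]‖ := by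
    rw [← sq_eq_sq₀ (norm_nonneg _) (norm_nonneg _), norm_sq_eq (_ + _)]
    simp
  rw [hQ.eq_of_norm_eq x hη]
  refine (Q.re_exponent_add_le x _ _ h0).trans_eq ?_
  rw [hQ.eq_of_norm_eq x (hn s rfl), hQ.eq_of_norm_eq x (hn (-s) (neg_sq s))]
  ring

/-- Integrate 1 - cos(t y_i) over 0 < t ≤ |ξ| and ν, in both orders. The constant is 80 = 4 · 20: 4
from doubling, 20 from the averaged cosine bound. -/
theorem LevyQuadruple.lintegral_coord_le {Q : LevyQuadruple 2}
    (hQ : IsRadialSymbol Q.exponent) {x : Space 2} (h0 : Q.a x = 0) {ξ : Space 2} (hξ : ξ ≠ 0)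
    (i : Fin 2) :
    ∫⁻ y, ENNReal.ofReal (min 1 (‖ξ‖ ^ 2 * y i ^ 2)) ∂(Q.ν x) ≤
      80 * ENNReal.ofReal (Q.exponent x ξ).re := by
  have hρ : 0 < ‖ξ‖ := norm_pos_iff.2 hξ
  set ρ := ‖ξ‖
  have := sFinite_of_lintegral_min_lt_top (Q.ν_zero x) (Q.ν_finite x)
  have h1 : ∫⁻ y, ENNReal.ofReal (ρ / 20) * ENNReal.ofReal (min 1 (ρ ^ 2 * y i ^ 2)) ∂(Q.ν x) ≤
      ∫⁻ y, (∫⁻ t in Ioc 0 ρ, ENNReal.ofReal (1 - Real.cos (t * y i))) ∂(Q.ν x) := by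
    refine lintegral_mono fun y => ?_
    rw [← ofReal_integral_eq_lintegral_ofReal
      ((by fun_prop : Continuous fun t : ℝ => 1 - Real.cos (t * y i)).integrableOn_Ioc)
      (Eventually.of_forall fun t => one_sub_cos_nonneg _), ← ENNReal.ofReal_mul (by positivity),
      ← intervalIntegral.integral_of_le hρ.le]
    exact ENNReal.ofReal_le_ofReal (integral_one_sub_cos_mul_ge hρ (y i))
  have h2 : ∫⁻ t in Ioc 0 ρ, ∫⁻ y, ENNReal.ofReal (1 - Real.cos (t * y i)) ∂(Q.ν x) ≤
      ENNReal.ofReal (4 * (Q.exponent x ξ).re) * ENNReal.ofReal ρ := by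
    calc _ ≤ ∫⁻ t in Ioc 0 ρ, ENNReal.ofReal (4 * (Q.exponent x ξ).re) := by
          refine setLIntegral_mono measurable_const fun t ht => ?_
          have h3 := Q.lintegral_one_sub_cos_le x (EuclideanSpace.single i t)
          simp only [EuclideanSpace.inner_single_left, RCLike.conj_to_real] at h3
          refine h3.trans (ENNReal.ofReal_le_ofReal (Q.re_exponent_le_four_mul hQ h0 ?_))
          rw [PiLp.norm_single, Real.norm_of_nonneg ht.1.le]
          linarith [ht.2]
      _ = _ := by simp
  rw [lintegral_lintegral_swap (by fun_prop)] at h1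
  rw [lintegral_const_mul' _ _ (by simp)] at h1
  have h4 := h1.trans h2
  have h5 : ENNReal.ofReal (4 * (Q.exponent x ξ).re) * ENNReal.ofReal ρ =
      ENNReal.ofReal (ρ / 20) * (80 * ENNReal.ofReal (Q.exponent x ξ).re) := by
    rw [ofNat_mul_ofReal, ← ENNReal.ofReal_mul' hρ.le,
      ← ENNReal.ofReal_mul (div_nonneg hρ.le (by norm_num))]
    congr 1
    ring
  rw [h5] at h4
  exact (ENNReal.mul_le_mul_iff_right (by simpa using hρ) (by simp)).1 h4

/-- The radial symbol dominates the truncated second moment of the Lévy measure. -/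
theorem LevyQuadruple.tailIntegral_le_re_exponent {Q : LevyQuadruple 2}
    (hQ : IsRadialSymbol Q.exponent) {x : Space 2} (h0 : Q.a x = 0) {ξ : Space 2} (hξ : ξ ≠ 0) :
    80⁻¹ * (ENNReal.ofReal (‖ξ‖ ^ 2) * tailIntegral Q.ν x ‖ξ‖⁻¹) ≤
      ENNReal.ofReal (Q.exponent x ξ).re := by
  have h1 : ∫⁻ y, ENNReal.ofReal (min 1 (‖ξ‖ ^ 2 * ‖y‖ ^ 2)) ∂(Q.ν x) ≤
      2 * (80 * ENNReal.ofReal (Q.exponent x ξ).re) := by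
    calc _ ≤ ∫⁻ y, (ENNReal.ofReal (min 1 (‖ξ‖ ^ 2 * y 0 ^ 2)) +
          ENNReal.ofReal (min 1 (‖ξ‖ ^ 2 * y 1 ^ 2))) ∂(Q.ν x) := by
          refine lintegral_mono fun y => ?_
          rw [← ENNReal.ofReal_add (by positivity) (by positivity)]
          refine ENNReal.ofReal_le_ofReal ?_
          rw [norm_sq_eq y, mul_add]
          have ha : 0 ≤ ‖ξ‖ ^ 2 * y 0 ^ 2 := by positivity
          have hb : 0 ≤ ‖ξ‖ ^ 2 * y 1 ^ 2 := by positivity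
          rw [← min_add_add_left, ← min_add_add_right, ← min_add_add_right]
          simp only [le_min_iff, min_le_iff]
          refine ⟨⟨?_, ?_⟩, ?_, ?_⟩ <;> first | (left; linarith) | (right; linarith)
      _ ≤ _ := by
          rw [lintegral_add_left (by fun_prop), two_mul]
          exact add_le_add (Q.lintegral_coord_le hQ h0 hξ 0) (Q.lintegral_coord_le hQ h0 hξ 1)
  rw [lintegral_min_sq Q.ν x (norm_pos_iff.2 hξ)] at h1
  -- The 2 from adding the two coordinates cancels the 2 of the layer cake formula.
  have h2 := (ENNReal.mul_le_mul_iff_right (by simp) (by simp)).1 h1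
  calc _ ≤ 80⁻¹ * (80 * ENNReal.ofReal (Q.exponent x ξ).re) := by gcongr
    _ = _ := by rw [← mul_assoc, ENNReal.inv_mul_cancel (by simp) (by simp), one_mul]

theorem LevyQuadruple.lintegral_one_sub_cos_le_tailIntegral (Q : LevyQuadruple 2)
    (x : Space 2) {ξ : Space 2} (hξ : ξ ≠ 0) :
    ∫⁻ y, ENNReal.ofReal (1 - Real.cos (inner ℝ ξ y)) ∂(Q.ν x) ≤
      4 * (ENNReal.ofReal (‖ξ‖ ^ 2) * tailIntegral Q.ν x ‖ξ‖⁻¹) := by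
  have h := lintegral_min_sq Q.ν x (norm_pos_iff.2 hξ)
  calc _ ≤ ∫⁻ y, 2 * ENNReal.ofReal (min 1 (‖ξ‖ ^ 2 * ‖y‖ ^ 2)) ∂(Q.ν x) := by
        refine lintegral_mono fun y => ?_
        rw [ofNat_mul_ofReal]
        exact ENNReal.ofReal_le_ofReal (one_sub_cos_le_two_mul_min _ _ (sq_inner_le ξ y))
    _ = _ := by
        rw [lintegral_const_mul' _ _ (by simp), h, ← mul_assoc]
        norm_num

/-- At a unit vector the growth bound gives 2c; the form is homogeneous of degree 2. -/
theorem LevyQuadruple.quadratic_le {d : ℕ} {Q : LevyQuadruple d} {c : ℝ}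
    (hc : ∀ x ξ, ‖Q.exponent x ξ‖ ≤ c * (1 + ‖ξ‖ ^ 2)) (x : Space d) {ξ : Space d} (hξ : ξ ≠ 0) :
    1 / 2 * (∑ i, ∑ j, ξ i * Q.C x i j * ξ j) ≤ 2 * c * ‖ξ‖ ^ 2 := by
  have hρ : 0 < ‖ξ‖ := norm_pos_iff.2 hξ
  have h1 := (Complex.re_le_norm _).trans (hc x (‖ξ‖⁻¹ • ξ))
  rw [Q.re_exponent, Q.quadratic_smul, norm_smul, norm_inv, norm_norm, inv_mul_cancel₀ hρ.ne'] at h1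
  have h2 := integral_nonneg (μ := Q.ν x)
    (f := fun y : Space d => 1 - Real.cos (inner ℝ (‖ξ‖⁻¹ • ξ) y)) fun y => one_sub_cos_nonneg _
  have h3 := Q.nonneg_a x
  set S := ∑ i, ∑ j, ξ i * Q.C x i j * ξ j
  have h4 : ‖ξ‖⁻¹ ^ 2 * (1 / 2 * S) ≤ 2 * c := by linarith
  rw [inv_pow, inv_mul_le_iff₀ (by positivity)] at h4
  linarith

theorem LevyQuadruple.re_exponent_le_tailIntegral {Q : LevyQuadruple 2} {c : ℝ}
    (hc : ∀ x ξ, ‖Q.exponent x ξ‖ ≤ c * (1 + ‖ξ‖ ^ 2)) {x : Space 2} (h0 : Q.a x = 0)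
    {ξ : Space 2} (hξ : ξ ≠ 0) :
    ENNReal.ofReal (Q.exponent x ξ).re ≤ (ENNReal.ofReal (2 * c) + 4) *
      (ENNReal.ofReal (‖ξ‖ ^ 2) * (1 + tailIntegral Q.ν x ‖ξ‖⁻¹)) := by
  rw [Q.re_exponent, h0, zero_add]
  refine ENNReal.ofReal_add_le.trans ?_
  have h1 := ENNReal.ofReal_le_ofReal (Q.quadratic_le hc x hξ)
  rw [ENNReal.ofReal_mul' (sq_nonneg ‖ξ‖)] at h1
  have h2 := Q.lintegral_one_sub_cos_le_tailIntegral x hξ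
  rw [← ofReal_integral_eq_lintegral_ofReal (integrable_one_sub_cos (Q.ν_finite x) ξ)
    (Eventually.of_forall fun y => one_sub_cos_nonneg _)] at h2
  refine (add_le_add h1 h2).trans ?_
  rw [add_mul]
  gcongr
  · exact le_mul_of_one_le_right' le_self_add
  · exact le_add_self

/-- The tail integral vanishes at one positive radius only if the Lévy measure does. -/
theorem LevyQuadruple.tailIntegral_eq_zero (Q : LevyQuadruple 2) {x : Space 2} {s : ℝ}
    (hs : 0 < s) (h : tailIntegral Q.ν x s = 0) (u : ℝ) : tailIntegral Q.ν x u = 0 := by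
  have h1 := lintegral_min_sq Q.ν x (inv_pos.2 hs)
  rw [inv_inv, h, mul_zero, mul_zero, lintegral_eq_zero_iff (by fun_prop)] at h1
  have h2 : Q.ν x = 0 := by
    rw [← Measure.measure_univ_eq_zero]
    refine measure_mono_null (t := {0} ∪ {0}ᶜ) (by simp) (measure_union_null (Q.ν_zero x) ?_)
    rw [Filter.EventuallyEq, ae_iff] at h1
    refine measure_mono_null (fun y (hy : y ≠ 0) => ?_) h1
    have : 0 < ‖y‖ := norm_pos_iff.2 hy
    simp only [Pi.zero_apply, ENNReal.ofReal_eq_zero, mem_ofPred_eq, not_le]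
    positivity
  simp [tailIntegral, h2]

/-! ### Integral tests for the supremum and the infimum -/

theorem supTailIntegral_anti (ν : Kernel (Space 2) (Space 2)) : Antitone (supTailIntegral ν) :=
  fun _ _ h => lintegral_mono_set (Ioi_subset_Ioi h)

theorem infTailIntegral_anti (ν : Kernel (Space 2) (Space 2)) : Antitone (infTailIntegral ν) :=
  fun _ _ h => lintegral_mono_set (Ioi_subset_Ioi h)

theorem transienceIntegral_mono (q : Space 2 → Space 2 → ℂ) : Monotone (transienceIntegral q) :=
  fun _ _ h => lintegral_mono_set (Metric.ball_subset_ball h)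

theorem monotone_iSup_tailIntegral (ν : Kernel (Space 2) (Space 2)) :
    Monotone fun s => ⨆ x, tailIntegral ν x s :=
  fun _ _ h => iSup_mono fun x => tailIntegral_mono ν x h

theorem monotone_iInf_tailIntegral (ν : Kernel (Space 2) (Space 2)) :
    Monotone fun s => ⨅ x, tailIntegral ν x s :=
  fun _ _ h => iInf_mono fun x => tailIntegral_mono ν x h

/-- If the tail integrals do not vanish, divergence does not depend on the lower limit. -/
theorem supTailIntegral_eq_top_of_eq_top (ν : Kernel (Space 2) (Space 2)) {r r' : ℝ} (hr : 0 < r)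
    (hS : ⨆ x, tailIntegral ν x r ≠ 0) (h : supTailIntegral ν r = ∞) :
    supTailIntegral ν r' = ∞ := by
  rcases le_total r' r with hrr | hrr
  · exact top_le_iff.1 (h ▸ supTailIntegral_anti ν hrr)
  -- On (r, r'] the integrand is at most its value at r, which is finite.
  have h1 : supTailIntegral ν r ≤ (∫⁻ _ in Ioc r r',
      (ENNReal.ofReal r * ⨆ x, tailIntegral ν x r)⁻¹) + supTailIntegral ν r' := by
    rw [supTailIntegral, ← Ioc_union_Ioi_eq_Ioi hrr]
    refine (lintegral_union_le _ _ _).trans (add_le_add ?_ le_rfl)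
    refine setLIntegral_mono measurable_const fun s hs => ?_
    rw [ENNReal.inv_le_inv]
    exact mul_le_mul' (ENNReal.ofReal_le_ofReal hs.1.le) (monotone_iSup_tailIntegral ν hs.1.le)
  rw [h, top_le_iff, ENNReal.add_eq_top] at h1
  refine h1.resolve_left ?_
  rw [setLIntegral_const]
  refine ENNReal.mul_ne_top ?_ (by simp)
  simp only [ne_eq, ENNReal.inv_eq_top, mul_eq_zero, not_or]
  exact ⟨by simpa using hr, hS⟩

variable {Q : LevyQuadruple 2}

theorem recurrenceIntegral_lt_top_iff (hQ : IsRadialSymbol Q.exponent) (h0 : ∀ x, Q.a x = 0) {c : ℝ}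
    (hc : ∀ x ξ, ‖Q.exponent x ξ‖ ≤ c * (1 + ‖ξ‖ ^ 2)) {r : ℝ} (hr : 0 < r)
    (hS : ⨆ x, tailIntegral Q.ν x r⁻¹ ≠ 0) :
    recurrenceIntegral Q.exponent r < ∞ ↔ supTailIntegral Q.ν r⁻¹ < ∞ := by
  refine lintegral_ball_inv_lt_top_iff (A := 80⁻¹) (B := ENNReal.ofReal (2 * c) + 4)
    (monotone_iSup_tailIntegral Q.ν) (by simp) (by simp) (by simp) (by finiteness)
    (fun ξ hξ => ?_) (fun ξ hξ => ?_) hr hS <;> simp only [Q.norm_exponent hQ]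
  · simp only [ENNReal.mul_iSup]
    exact iSup_mono fun x => Q.tailIntegral_le_re_exponent hQ (h0 x) hξ
  · refine iSup_le fun x => (Q.re_exponent_le_tailIntegral hc (h0 x) hξ).trans ?_
    gcongr
    exact le_iSup (fun x => tailIntegral Q.ν x ‖ξ‖⁻¹) x

theorem transienceIntegral_lt_top_iff (hQ : IsRadialSymbol Q.exponent) (h0 : ∀ x, Q.a x = 0) {c : ℝ}
    (hc : ∀ x ξ, ‖Q.exponent x ξ‖ ≤ c * (1 + ‖ξ‖ ^ 2)) {r : ℝ} (hr : 0 < r)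
    (hS : ⨅ x, tailIntegral Q.ν x r⁻¹ ≠ 0) :
    transienceIntegral Q.exponent r < ∞ ↔ infTailIntegral Q.ν r⁻¹ < ∞ := by
  refine lintegral_ball_inv_lt_top_iff (A := 80⁻¹) (B := ENNReal.ofReal (2 * c) + 4)
    (monotone_iInf_tailIntegral Q.ν) (by simp) (by simp) (by simp) (by finiteness)
    (fun ξ hξ => ?_) (fun ξ hξ => ?_) hr hS
  · refine le_iInf fun x => le_trans ?_ (Q.tailIntegral_le_re_exponent hQ (h0 x) hξ)
    gcongr
    exact iInf_le (fun x => tailIntegral Q.ν x ‖ξ‖⁻¹) x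
  · rw [ENNReal.add_iInf, ENNReal.mul_iInf_of_ne (by simpa using hξ) (by simp),
      ENNReal.mul_iInf_of_ne (by simp) (by finiteness)]
    exact iInf_mono fun x => Q.re_exponent_le_tailIntegral hc (h0 x) hξ

/-- A single frequency of length ε/2 at which the infimum exceeds 1 gives tail integrals at least
1/4 at radius 2/ε for all x; monotonicity does the rest. -/
theorem SecondMomentBlowUp.exists_iInf_tailIntegral_ne_zero (h : SecondMomentBlowUp Q.ν) :
    ∃ s₀ : ℝ, 0 < s₀ ∧ ∀ s, s₀ ≤ s → ⨅ x, tailIntegral Q.ν x s ≠ 0 := by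
  have h1 := eventually_lt_of_lt_liminf (b := 1) (h ▸ ENNReal.one_lt_top)
  obtain ⟨ε, hε, hball⟩ := Metric.mem_nhdsWithin_iff.1 h1
  have hs : ⨅ x, tailIntegral Q.ν x (2 / ε) ≠ 0 := by
    set ξ : Space 2 := EuclideanSpace.single 0 (ε / 2) with hξ
    have hn : ‖ξ‖ = ε / 2 := by rw [hξ, PiLp.norm_single, Real.norm_of_nonneg (by positivity)]
    have hξ0 : ξ ≠ 0 := norm_pos_iff.1 (by rw [hn]; positivity)
    have h2 : 1 < ⨅ x, ∫⁻ y, ENNReal.ofReal ((1 - Real.cos (inner ℝ ξ y)) / ‖ξ‖ ^ 2) ∂(Q.ν x) :=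
      hball ⟨by rw [mem_ball_zero_iff, hn]; linarith, hξ0⟩
    have h3 : (4⁻¹ : ℝ≥0∞) ≤ ⨅ x, tailIntegral Q.ν x (2 / ε) := by
      refine le_iInf fun x => ?_
      have h4 := h2.le.trans (iInf_le _ x)
      have hpos : 0 < ‖ξ‖ ^ 2 := by rw [hn]; positivity
      simp only [ENNReal.ofReal_div_of_pos hpos] at h4
      simp only [div_eq_mul_inv] at h4
      rw [lintegral_mul_const' _ _ (by simpa using hξ0)] at h4
      have h5 := h4.trans (mul_le_mul_left
        (Q.lintegral_one_sub_cos_le_tailIntegral x hξ0) _)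
      rw [mul_comm, mul_left_comm, ← mul_assoc _ _ (tailIntegral _ _ _),
        ENNReal.inv_mul_cancel (by simpa using hξ0) (by simp), one_mul, hn, inv_div] at h5
      rw [ENNReal.inv_le_iff_le_mul (by simp) (by simp)]
      exact h5
    exact fun h => by simp [h] at h3
  exact ⟨2 / ε, by positivity, fun s hs' h' => hs (le_antisymm
    ((monotone_iInf_tailIntegral Q.ν hs').trans_eq h') zero_le)⟩

end LevyType

/-! ### The main theorem -/

theorem theorem4p4 {Ω : Type*} [MeasurableSpace Ω]
    (X : LevyType.FellerProcess 2 Ω)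
    (q : LevyType.Space 2 → LevyType.Space 2 → ℂ)
    (Q : LevyType.LevyQuadruple 2)
    (hX : LevyType.IsLevyTypeProcess X q Q)
    (hq : LevyType.IsRadialSymbol q)
    (hν : LevyType.UniformlyQuasiUnimodal Q.ν) :
    ((∃ r : ℝ, 0 < r ∧ LevyType.recurrenceIntegral q r = ∞) ↔
        ∃ r : ℝ, 0 < r ∧ LevyType.supTailIntegral Q.ν r = ∞) ∧
      ((∃ r : ℝ, 0 < r ∧ LevyType.supTailIntegral Q.ν r = ∞) ↔
        ∀ r : ℝ, 0 < r → LevyType.supTailIntegral Q.ν r = ∞) ∧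
      (LevyType.SecondMomentBlowUp Q.ν →
        ((∃ r : ℝ, 0 < r ∧ LevyType.transienceIntegral q r < ∞) ↔
          ∃ r : ℝ, 0 < r ∧ LevyType.infTailIntegral Q.ν r < ∞)) := by
  obtain rfl : q = Q.exponent := funext fun x => funext fun ξ => hX.levyKhintchine x ξ
  have h0 : ∀ x, Q.a x = 0 := fun x => by
    have := hX.noKilling x
    rwa [Q.exponent_zero, Complex.ofReal_eq_zero] at this
  obtain ⟨c, -, hc⟩ := hX.boundedCoefficients
  refine ⟨?_, ?_, fun hB => ?_⟩
  -- If the supremum vanishes at some radius, all tail integrals are zero, the symbol is O(|ξ|²)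
  -- uniformly in x, and both integrals are infinite.
  · by_cases hS : ∃ s, 0 < s ∧ ⨆ x, LevyType.tailIntegral Q.ν x s = 0
    · obtain ⟨s, hs, hs0⟩ := hS
      have hT : ∀ x u, LevyType.tailIntegral Q.ν x u = 0 := fun x u =>
        Q.tailIntegral_eq_zero hs (ENNReal.iSup_eq_zero.1 hs0 x) u
      refine iff_of_true ⟨1, one_pos, ?_⟩ ⟨1, one_pos, by simp [LevyType.supTailIntegral, hT]⟩
      refine LevyType.lintegral_ball_inv_eq_top (B := ENNReal.ofReal (2 * c) + 4) (by finiteness)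
        (fun ξ hξ => iSup_le fun x => ?_) one_pos
      simpa [hT, Q.norm_exponent hq] using Q.re_exponent_le_tailIntegral hc (h0 x) hξ
    · push Not at hS
      have key : ∀ r, 0 < r → (LevyType.recurrenceIntegral Q.exponent r = ∞ ↔
          LevyType.supTailIntegral Q.ν r⁻¹ = ∞) := fun r hr => by
        have := LevyType.recurrenceIntegral_lt_top_iff hq h0 hc hr (hS _ (inv_pos.2 hr))
        rw [lt_top_iff_ne_top, lt_top_iff_ne_top] at this
        exact not_iff_not.1 this
      constructor
      · rintro ⟨r, hr, h⟩
        exact ⟨r⁻¹, inv_pos.2 hr, (key r hr).1 h⟩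
      · rintro ⟨r, hr, h⟩
        exact ⟨r⁻¹, inv_pos.2 hr, (key _ (inv_pos.2 hr)).2 (by rwa [inv_inv])⟩
  · refine ⟨fun ⟨r, hr, h⟩ r' _ => ?_, fun h => ⟨1, one_pos, h 1 one_pos⟩⟩
    by_cases hS : ⨆ x, LevyType.tailIntegral Q.ν x r = 0
    · have hT : ∀ x u, LevyType.tailIntegral Q.ν x u = 0 := fun x u =>
        Q.tailIntegral_eq_zero hr (ENNReal.iSup_eq_zero.1 hS x) u
      simp [LevyType.supTailIntegral, hT]
    · exact LevyType.supTailIntegral_eq_top_of_eq_top Q.ν hr hS h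
  · obtain ⟨s₀, hs₀, hS⟩ := hB.exists_iInf_tailIntegral_ne_zero
    constructor
    · rintro ⟨r, hr, h⟩
      -- Shrinking the ball puts its inverse radius beyond s₀, where the infimum is nonzero.
      have hm : 0 < min r s₀⁻¹ := lt_min hr (inv_pos.2 hs₀)
      refine ⟨(min r s₀⁻¹)⁻¹, inv_pos.2 hm,
        (LevyType.transienceIntegral_lt_top_iff hq h0 hc hm (hS _ ?_)).1
          ((LevyType.transienceIntegral_mono _ (min_le_left _ _)).trans_lt h)⟩
      exact (le_inv_comm₀ hs₀ hm).2 (min_le_right _ _)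
    · rintro ⟨r, hr, h⟩
      have hm : 0 < max r s₀ := lt_max_of_lt_left hr
      refine ⟨(max r s₀)⁻¹, inv_pos.2 hm,
        (LevyType.transienceIntegral_lt_top_iff hq h0 hc (inv_pos.2 hm) (hS _ ?_)).2 ?_⟩
      · rw [inv_inv]; exact le_max_right _ _
      · rw [inv_inv]
        exact (LevyType.infTailIntegral_anti _ (le_max_left _ _)).trans_lt h
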